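/- Let $n,p\ge 1$, let $\lambda_1,\lambda_2>0$, and let $A$ be a simple undirected graph on $\{1,\dots,n\}$. For a data matrix $X\in\mathbb{R}^{n\times p}$ with columns $X_1,\dots,X_p$, a $p\times p$ matrix $\Phi=(\phi_1,\dots,\phi_p)$, a positive diagonal matrix $D=\mathrm{diag}(\rho_1^2,\dots,\rho_p^2)$ with $\rho_j>0$, and a positive definite $n\times n$ matrix $\Theta=(\theta_{ij})$, put $$f(\Phi,D,\Theta)=-n\log\det D-p\log\det\Theta+\mathrm{Tr}\Big(\Theta\cdot\frac1p\sum_{j=1}^p(\rho_jX_j-X\phi_j)(\rho_jX_j-X\phi_j)^\top\Big)+\lambda_1\sum_{i,j}|\phi_{ij}|+\lambda_2\sum_{i\neq j}|\theta_{ij}|.$$ Consider minimizing $f$ over the feasible set $\mathcal F$ of all $(\Phi,D,\Theta)$ such that $\phi_{ij}=0$ whenever $j\le i$; $D$ is diagonal with positive diagonal entries; and $\Theta$ is symmetric positive definite with $(\Theta^{-1})_{ii}=1$ for all $i$ and $\theta_{ij}=0$ for all $i\ne j$ not adjacent in $A$. Outside $\mathcal F$ put $f=+\infty$. A sequence generated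 by block coordinate descent starts at a point of $\mathcal F$ and, cycling through the blocks $\Phi,D,\Theta$ in this order, replaces at each step one block by a global minimizer of $f$ over the feasible values of that block, the other two blocks being kept. Then for Lebesgue-almost every $X\in\mathbb{R}^{n\times p}$ the following holds for every sequence generated by block coordinate descent. Every cluster point $z$ of the iterates (all intermediate iterates included, hence in particular every cluster point of the subsequence of iterates after complete cycles) is a stationary point of the problem: $z\in\mathcal F$, and all directional derivatives at $z$ are nonnegative. Precisely: (a) $\liminf_{t\downarrow0}\,\bigl(f(z+td)-f(z)\bigr)/t\ge 0$ for every direction $d$, where $f=+\infty$ off $\mathcal F$; (b) for every direction $d$ tangent to $\mathcal F$ at $z$ (that is, $d=\lim_k c_k(z_k-z)$ for some $z_k\in\mathcal F$ with $z_k\to z$ and $c_k\ge 0$), the one-sided directional derivative at $z$ in direction $d$ of the finite expression displayed above exists and is nonnegative. -/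

import Mathlib

open Filter Topology MeasureTheory

noncomputable section

namespace NetworkDAG

/-- The parameters `(Φ, D, Θ)`. The diagonal matrix `D = diag (ρ₁², …, ρₚ²)` is represented by
the vector of its diagonal entries. -/
abbrev Params (n p : ℕ) : Type :=
  Matrix (Fin p) (Fin p) ℝ × (Fin p → ℝ) × Matrix (Fin n) (Fin n) ℝ

/-- The `j`-th residual `ρⱼ Xⱼ - X φⱼ ∈ ℝⁿ`, where `ρⱼ` is the square root of the `j`-th diagonal
entry of `D`, and `Xⱼ`, `φⱼ` are the `j`-th columns of `X`, `Φ`. -/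
def residual {n p : ℕ} (X : Matrix (Fin n) (Fin p) ℝ) (Φ : Matrix (Fin p) (Fin p) ℝ)
    (D : Fin p → ℝ) (j : Fin p) : Fin n → ℝ :=
  √(D j) • X.col j - X.mulVec (Φ.col j)

/-- `S(Φ, D) = (1/p) ∑ⱼ (ρⱼ Xⱼ - X φⱼ) (ρⱼ Xⱼ - X φⱼ)ᵀ`. -/
def scatter {n p : ℕ} (X : Matrix (Fin n) (Fin p) ℝ) (Φ : Matrix (Fin p) (Fin p) ℝ)
    (D : Fin p → ℝ) : Matrix (Fin n) (Fin n) ℝ :=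
  (1 / (p : ℝ)) • ∑ j, Matrix.vecMulVec (residual X Φ D j) (residual X Φ D j)

/-- `L(Φ, D, Θ ∣ X) = - n log det D - p log det Θ + Tr (Θ S(Φ, D))`. -/
def negLogLik {n p : ℕ} (X : Matrix (Fin n) (Fin p) ℝ) (z : Params n p) : ℝ :=
  -(n : ℝ) * Real.log (Matrix.diagonal z.2.1).det - (p : ℝ) * Real.log z.2.2.det
    + (z.2.2 * scatter X z.1 z.2.1).trace

/-- The penalized objective `L(Φ, D, Θ ∣ X) + l₁ ‖Φ‖₁ + l₂ ‖Θ‖₁`; the norm `‖Θ‖₁` runs over the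
off-diagonal entries only. -/
def objective {n p : ℕ} (l₁ l₂ : ℝ) (X : Matrix (Fin n) (Fin p) ℝ) (z : Params n p) : ℝ :=
  negLogLik X z + l₁ * ∑ j, ∑ i, |z.1 i j|
    + l₂ * ∑ i, ∑ j, if i ≠ j then |z.2.2 i j| else 0

/-- Coefficient matrices `Φ` compatible with the given ordering of the nodes. -/
def PhiSet (p : ℕ) : Set (Matrix (Fin p) (Fin p) ℝ) :=
  {Φ | ∀ i j, j ≤ i → Φ i j = 0}

/-- Positive diagonal matrices `D`. -/
def DSet (p : ℕ) : Set (Fin p → ℝ) :=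
  {D | ∀ j, 0 < D j}

/-- Positive definite matrices `Θ` with `diag (Θ⁻¹) = 1` whose off-diagonal support is contained in
the edge set of the network `G` among the individuals. -/
def ThetaSet {n : ℕ} (G : SimpleGraph (Fin n)) : Set (Matrix (Fin n) (Fin n) ℝ) :=
  {Θ | Θ.PosDef ∧ (∀ i, Θ⁻¹ i i = 1) ∧ ∀ i j, i ≠ j → ¬ G.Adj i j → Θ i j = 0}

/-- The feasible set of the penalized likelihood problem. -/
def feasible {n : ℕ} (p : ℕ) (G : SimpleGraph (Fin n)) : Set (Params n p) :=
  {z | z.1 ∈ PhiSet p ∧ z.2.1 ∈ DSet p ∧ z.2.2 ∈ ThetaSet G}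

/-- One exact minimization over a single block, the other two blocks being kept:
`Φ` if `r ≡ 0`, `D` if `r ≡ 1`, `Θ` if `r ≡ 2` modulo `3`. -/
def BlockStep {n p : ℕ} (G : SimpleGraph (Fin n)) (l₁ l₂ : ℝ) (X : Matrix (Fin n) (Fin p) ℝ)
    (r : ℕ) (z w : Params n p) : Prop :=
  (r % 3 = 0 → w.2 = z.2 ∧ w.1 ∈ PhiSet p ∧
    IsMinOn (fun Φ => objective l₁ l₂ X (Φ, z.2.1, z.2.2)) (PhiSet p) w.1) ∧
  (r % 3 = 1 → w.1 = z.1 ∧ w.2.2 = z.2.2 ∧ w.2.1 ∈ DSet p ∧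
    IsMinOn (fun D => objective l₁ l₂ X (z.1, D, z.2.2)) (DSet p) w.2.1) ∧
  (r % 3 = 2 → w.1 = z.1 ∧ w.2.1 = z.2.1 ∧ w.2.2 ∈ ThetaSet G ∧
    IsMinOn (fun Θ => objective l₁ l₂ X (z.1, z.2.1, Θ)) (ThetaSet G) w.2.2)

/-- A sequence generated by block coordinate descent from a feasible starting point, cycling
through `Φ, D, Θ`. All intermediate iterates are listed: `x (3 * t)` is the iterate after `t`
complete cycles. -/
def IsBCDSequence {n p : ℕ} (G : SimpleGraph (Fin n)) (l₁ l₂ : ℝ)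
    (X : Matrix (Fin n) (Fin p) ℝ) (x : ℕ → Params n p) : Prop :=
  x 0 ∈ feasible p G ∧ ∀ r, BlockStep G l₁ l₂ X r (x r) (x (r + 1))

open Classical in
/-- The objective of the constrained problem as an extended real valued function, equal to `+∞` at
infeasible points. -/
def extObjective {n p : ℕ} (G : SimpleGraph (Fin n)) (l₁ l₂ : ℝ)
    (X : Matrix (Fin n) (Fin p) ℝ) (z : Params n p) : EReal :=
  if z ∈ feasible p G then ((objective l₁ l₂ X z : ℝ) : EReal) else ⊤

/-- The (lower) directional derivative `f'(z; d) = liminf_{t ↓ 0} (f (z + t d) - f z) / t` of an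
extended real valued function. -/
def lowerDirDeriv {E : Type*} [AddCommGroup E] [Module ℝ E] (f : E → EReal) (z d : E) : EReal :=
  liminf (fun t : ℝ => (f (z + t • d) - f z) / (t : EReal)) (𝓝[>] 0)

/-- Stationary point of an extended real valued function: a point of the domain at which all
directional derivatives are nonnegative. -/
def IsStationaryPoint {E : Type*} [AddCommGroup E] [Module ℝ E] (f : E → EReal) (z : E) : Prop :=
  f z < ⊤ ∧ ∀ d, 0 ≤ lowerDirDeriv f z d

/-- First-order stationarity of `z` for minimizing `g` over `s`: the one-sided directional
derivative of `g` at `z ∈ s` exists and is nonnegative in every direction `d` tangent to `s` at `z`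
(a limit of `cₖ (zₖ - z)` with `zₖ ∈ s`, `zₖ → z`, `cₖ ≥ 0`). -/
def IsTangentStationaryOn {E : Type*} [AddCommGroup E] [Module ℝ E] [TopologicalSpace E]
    (g : E → ℝ) (s : Set E) (z : E) : Prop :=
  z ∈ s ∧ ∀ d ∈ posTangentConeAt s z,
    ∃ m : ℝ, 0 ≤ m ∧ HasDerivWithinAt (fun t : ℝ => g (z + t • d)) m (Set.Ici 0) 0

end NetworkDAG

end

/-!
The proof has two parts.

*Cluster points are blockwise minimizers.* The normalization `diag Θ⁻¹ = 1` gives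
`vᵢ² ≤ vᵀ Θ v` for all `v` and `i` (`sq_le_quadForm`), so the set of feasible `Θ` is closed. Together
with the barrier `-n log det D` this makes every cluster point `z` feasible, and the monotone
sequence of objective values converges to the value at `z`. If a subsequence of iterates converges
to `z`, comparing with the exact minimizations just before and just after it shows that `z` is
optimal in two of the three blocks. For the third block one needs to control a neighbouring step.
For fixed `Θ` the objective is convex in `(Φ, ρ)`, where `Dⱼ = ρⱼ²`, and uniformly strongly convex in
the residuals `ρⱼ Xⱼ - X φⱼ` (`objective_midpoint_le`); hence the change of the residuals in a
`Φ`-step or a `D`-step is bounded by the decrease of the objective and tends to `0`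
(`IsBCDSequence.tendsto_residual_sub`).

* If no column of `X` vanishes, which is so for almost every `X`, the residuals determine `ρ`, so the
  iterates before and after a `D`-step have the same limits. This covers the limits of iterates that
  precede or follow a `D`-step.
* For limits of iterates from which a `Φ`-step starts, optimality in `D` is to be shown. The
  `Φ`-step need not converge, since the minimizer in `Φ` need not be unique; but the objective
  depends on `D` only through `det D` and the residuals, and these are asymptotically unchanged
  (`IsBCDSequence.isBlockMin_one_of_tendsto_before_zero`).

No compactness of the iterates and no uniqueness in `Φ` or `Θ` is involved.

*Blockwise minimizers are stationary.* The objective is the sum of a differentiable function and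
multiples of absolute values of single entries, so that it has one-sided directional derivatives in
the sense of Hadamard (`HasDirDerivAt`) which are additive over the blocks. The feasible set is a
product, so each block of a tangent direction is tangent, and the derivative along it is nonnegative
by optimality of the block (`IsBlockMin.objectiveDirDeriv_nonneg`).
-/

namespace NetworkDAG

variable {n p : ℕ}

/-! ### The objective function -/

lemma trace_mul_scatter (X : Matrix (Fin n) (Fin p) ℝ) (Φ : Matrix (Fin p) (Fin p) ℝ)
    (D : Fin p → ℝ) (Θ : Matrix (Fin n) (Fin n) ℝ) :
    (Θ * scatter X Φ D).trace =
      (1 / (p : ℝ)) * ∑ j, residual X Φ D j ⬝ᵥ Θ.mulVec (residual X Φ D j) := by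
  simp only [scatter, Matrix.mul_smul, Matrix.mul_sum, Matrix.mul_vecMulVec, Matrix.trace_smul,
    Matrix.trace_sum, Matrix.trace_vecMulVec, smul_eq_mul]
  simp only [dotProduct_comm]

lemma objective_eq (l₁ l₂ : ℝ) (X : Matrix (Fin n) (Fin p) ℝ) (Φ : Matrix (Fin p) (Fin p) ℝ)
    (D : Fin p → ℝ) (Θ : Matrix (Fin n) (Fin n) ℝ) :
    objective l₁ l₂ X (Φ, D, Θ) =
      -(n : ℝ) * Real.log (∏ j, D j) - (p : ℝ) * Real.log Θ.det
        + (1 / (p : ℝ)) * ∑ j, residual X Φ D j ⬝ᵥ Θ.mulVec (residual X Φ D j)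
        + l₁ * ∑ j, ∑ i, |Φ i j| + l₂ * ∑ i, ∑ j, if i ≠ j then |Θ i j| else 0 := by
  simp only [objective, negLogLik, trace_mul_scatter, Matrix.det_diagonal]

lemma residual_apply (X : Matrix (Fin n) (Fin p) ℝ) (Φ : Matrix (Fin p) (Fin p) ℝ)
    (D : Fin p → ℝ) (j : Fin p) (i : Fin n) :
    residual X Φ D j i = √(D j) * X i j - ∑ k, X i k * Φ k j := by
  simp [residual, Matrix.mulVec, dotProduct]

lemma continuous_residual (X : Matrix (Fin n) (Fin p) ℝ) (j : Fin p) :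
    Continuous fun w : Matrix (Fin p) (Fin p) ℝ × (Fin p → ℝ) => residual X w.1 w.2 j := by
  refine continuous_pi fun i => ?_
  simp only [residual_apply]
  have (k : Fin p) : Continuous fun w : Matrix (Fin p) (Fin p) ℝ × (Fin p → ℝ) => w.1 k j :=
    continuous_fst.matrix_elem k j
  fun_prop

lemma continuous_quadForm :
    Continuous fun w : Matrix (Fin n) (Fin n) ℝ × (Fin n → ℝ) => w.2 ⬝ᵥ w.1.mulVec w.2 :=
  continuous_snd.dotProduct (continuous_fst.matrix_mulVec continuous_snd)

lemma tendsto_residual {ι : Type*} {l : Filter ι} (X : Matrix (Fin n) (Fin p) ℝ)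
    {Φ : ι → Matrix (Fin p) (Fin p) ℝ} {D : ι → Fin p → ℝ} {Φ₀ : Matrix (Fin p) (Fin p) ℝ}
    {D₀ : Fin p → ℝ} (hΦ : Tendsto Φ l (𝓝 Φ₀)) (hD : Tendsto D l (𝓝 D₀)) (j : Fin p) :
    Tendsto (fun k => residual X (Φ k) (D k) j) l (𝓝 (residual X Φ₀ D₀ j)) :=
  ((continuous_residual X j).tendsto (Φ₀, D₀)).comp (hΦ.prodMk_nhds hD)

lemma tendsto_quadForm {ι : Type*} {l : Filter ι} {Θ : ι → Matrix (Fin n) (Fin n) ℝ}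
    {v : ι → Fin n → ℝ} {Θ₀ : Matrix (Fin n) (Fin n) ℝ} {v₀ : Fin n → ℝ}
    (hΘ : Tendsto Θ l (𝓝 Θ₀)) (hv : Tendsto v l (𝓝 v₀)) :
    Tendsto (fun k => v k ⬝ᵥ (Θ k).mulVec (v k)) l (𝓝 (v₀ ⬝ᵥ Θ₀.mulVec v₀)) :=
  (continuous_quadForm.tendsto (Θ₀, v₀)).comp (hΘ.prodMk_nhds hv)

lemma continuousAt_objective (l₁ l₂ : ℝ) (X : Matrix (Fin n) (Fin p) ℝ) {z : Params n p}
    (hD : z.2.1 ∈ DSet p) (hΘ : z.2.2.det ≠ 0) : ContinuousAt (objective l₁ l₂ X) z := by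
  have hD' : (∏ j, z.2.1 j) ≠ 0 := Finset.prod_ne_zero_iff.2 fun j _ => (hD j).ne'
  have h1 : ContinuousAt (fun z : Params n p => Real.log (∏ j, z.2.1 j)) z :=
    ContinuousAt.log (by fun_prop) hD'
  have h2 : ContinuousAt (fun z : Params n p => Real.log z.2.2.det) z :=
    ContinuousAt.log
      (Continuous.matrix_det (continuous_snd.comp continuous_snd)).continuousAt hΘ
  have h3 (j : Fin p) : Continuous fun z : Params n p =>
      residual X z.1 z.2.1 j ⬝ᵥ z.2.2.mulVec (residual X z.1 z.2.1 j) :=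
    continuous_quadForm.comp ((continuous_snd.comp continuous_snd).prodMk
      ((continuous_residual X j).comp (continuous_fst.prodMk (continuous_fst.comp continuous_snd))))
  have h4 (i j : Fin p) : Continuous fun z : Params n p => z.1 i j :=
    continuous_fst.matrix_elem i j
  have h5 (i j : Fin n) : Continuous fun z : Params n p => if i ≠ j then |z.2.2 i j| else 0 := by
    have := (continuous_snd.comp continuous_snd : Continuous fun z : Params n p => z.2.2).matrix_elem
      i j
    split_ifs <;> fun_prop
  have h3' := continuous_finsetSum Finset.univ fun j _ => h3 j
  have h4' := continuous_finsetSum Finset.univ fun j _ =>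
    continuous_finsetSum Finset.univ fun i _ => (h4 i j).abs
  have h5' := continuous_finsetSum Finset.univ fun i _ =>
    continuous_finsetSum Finset.univ fun j _ => h5 i j
  have : objective l₁ l₂ X = fun z : Params n p => _ := funext fun z => objective_eq l₁ l₂ X _ _ _
  rw [this]
  exact (((continuousAt_const.mul h1).sub (continuousAt_const.mul h2)).add
    (continuousAt_const.mul h3'.continuousAt)).add (continuousAt_const.mul h4'.continuousAt) |>.add
    (continuousAt_const.mul h5'.continuousAt)

/-! ### The feasible precision matrices -/

/-- Cauchy-Schwarz in the inner product of `Θ`, applied to `v` and the `i`-th column of `Θ⁻¹`.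
It is a lower bound on the quadratic form of `Θ` that is uniform over `ThetaSet G`. -/
lemma sq_le_quadForm {G : SimpleGraph (Fin n)} {Θ : Matrix (Fin n) (Fin n) ℝ}
    (hΘ : Θ ∈ ThetaSet G) (v : Fin n → ℝ) (i : Fin n) : v i ^ 2 ≤ v ⬝ᵥ Θ.mulVec v := by
  obtain ⟨hpd, hdiag, -⟩ := hΘ
  have hdet : IsUnit Θ.det := hpd.det_pos.ne'.isUnit
  have hsymm : Θ.transpose = Θ := by simpa using hpd.isHermitian.eq
  set c : Fin n → ℝ := Θ⁻¹.mulVec (Pi.single i 1) with hc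
  have hci : c i = 1 := by rw [hc]; simp [hdiag i]
  have hΘc : Θ.mulVec c = Pi.single i 1 := by
    rw [hc, Matrix.mulVec_mulVec, Matrix.mul_nonsing_inv _ hdet, Matrix.one_mulVec]
  have hcv : c ⬝ᵥ Θ.mulVec v = v i := by
    rw [Matrix.dotProduct_mulVec, ← Matrix.mulVec_transpose, hsymm, hΘc, single_one_dotProduct]
  have h0 : 0 ≤ (v - v i • c) ⬝ᵥ Θ.mulVec (v - v i • c) := by
    simpa using hpd.posSemidef.dotProduct_mulVec_nonneg (v - v i • c)
  have h1 : (v - v i • c) ⬝ᵥ Θ.mulVec (v - v i • c) = v ⬝ᵥ Θ.mulVec v - v i ^ 2 := by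
    rw [Matrix.mulVec_sub, Matrix.mulVec_smul, hΘc]
    simp only [sub_dotProduct, dotProduct_sub, smul_dotProduct, dotProduct_smul, hcv,
      dotProduct_single_one, Pi.sub_apply, Pi.smul_apply, hci, smul_eq_mul]
    ring
  linarith

lemma quadForm_nonneg {G : SimpleGraph (Fin n)} {Θ : Matrix (Fin n) (Fin n) ℝ}
    (hΘ : Θ ∈ ThetaSet G) (v : Fin n → ℝ) : 0 ≤ v ⬝ᵥ Θ.mulVec v := by
  simpa using hΘ.1.posSemidef.dotProduct_mulVec_nonneg v

/-- The normalization `diag Θ⁻¹ = 1` keeps the positive definite matrices away from the singular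
ones, by `sq_le_quadForm`. -/
lemma isClosed_thetaSet (G : SimpleGraph (Fin n)) : IsClosed (ThetaSet G) := by
  refine isClosed_of_closure_subset fun Θ hΘ => ?_
  have : FirstCountableTopology (Matrix (Fin n) (Fin n) ℝ) :=
    inferInstanceAs (FirstCountableTopology (Fin n → Fin n → ℝ))
  obtain ⟨u, hu, hlim⟩ := mem_closure_iff_seq_limit.1 hΘ
  have hentry (i j : Fin n) : Tendsto (fun k => u k i j) atTop (𝓝 (Θ i j)) :=
    ((continuous_id.matrix_elem i j).tendsto Θ).comp hlim
  have hherm : Θ.IsHermitian := by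
    refine Matrix.IsHermitian.ext fun i j => ?_
    refine tendsto_nhds_unique (hentry j i) ((hentry i j).congr fun k => ?_)
    simpa using (hu k).1.isHermitian.apply j i
  have hquad (v : Fin n → ℝ) (i : Fin n) : v i ^ 2 ≤ v ⬝ᵥ Θ.mulVec v :=
    ge_of_tendsto' ((continuous_quadForm.tendsto (Θ, v)).comp (hlim.prodMk_nhds tendsto_const_nhds))
      fun k => sq_le_quadForm (hu k) v i
  have hpd : Θ.PosDef := by
    refine Matrix.posDef_iff_dotProduct_mulVec.2 ⟨hherm, fun v hv => ?_⟩
    obtain ⟨i, hi⟩ := Function.ne_iff.1 hv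
    simpa using (sq_pos_of_ne_zero hi).trans_le (hquad v i)
  refine ⟨hpd, fun i => ?_, fun i j hij hG => ?_⟩
  · have hdet : IsUnit Θ.det := hpd.det_pos.ne'.isUnit
    have hinv : ContinuousAt (fun M : Matrix (Fin n) (Fin n) ℝ => M⁻¹) Θ := by
      simp only [Matrix.inv_def, Ring.inverse_eq_inv']
      exact ((Continuous.matrix_det continuous_id).continuousAt.inv₀ hdet.ne_zero).smul
        (Continuous.matrix_adjugate continuous_id).continuousAt
    have := ((continuous_id.matrix_elem i i).tendsto Θ⁻¹).comp (hinv.tendsto.comp hlim)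
    exact tendsto_nhds_unique this (tendsto_const_nhds.congr fun k => ((hu k).2.1 i).symm)
  · exact tendsto_nhds_unique (hentry i j)
      (tendsto_const_nhds.congr fun k => ((hu k).2.2 i j hij hG).symm)

lemma isClosed_phiSet (p : ℕ) : IsClosed (PhiSet p) := by
  simp only [PhiSet, Set.ofPred_forall]
  exact isClosed_iInter fun i => isClosed_iInter fun j => isClosed_iInter fun _ =>
    isClosed_eq (continuous_id.matrix_elem i j) continuous_const

lemma continuousAt_objective_of_feasible (l₁ l₂ : ℝ) (X : Matrix (Fin n) (Fin p) ℝ)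
    {G : SimpleGraph (Fin n)} {z : Params n p} (hz : z ∈ feasible p G) :
    ContinuousAt (objective l₁ l₂ X) z :=
  continuousAt_objective l₁ l₂ X hz.2.1 hz.2.2.1.det_pos.ne'

/-- Limits of feasible points at which the objective stays bounded above are feasible: the term
`-n log det D` is a barrier at the boundary of `DSet p`, and the other constraints are closed. -/
lemma mem_feasible_of_tendsto (hn : 1 ≤ n) {l₁ l₂ : ℝ} (hl₁ : 0 ≤ l₁) (hl₂ : 0 ≤ l₂)
    (X : Matrix (Fin n) (Fin p) ℝ) {G : SimpleGraph (Fin n)} {u : ℕ → Params n p}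
    {z : Params n p} {c : ℝ} (hu : ∀ k, u k ∈ feasible p G) (hc : ∀ k, objective l₁ l₂ X (u k) ≤ c)
    (hlim : Tendsto u atTop (𝓝 z)) : z ∈ feasible p G := by
  have hΦ : Tendsto (fun k => (u k).1) atTop (𝓝 z.1) := (continuous_fst.tendsto z).comp hlim
  have hD : Tendsto (fun k => (u k).2.1) atTop (𝓝 z.2.1) :=
    ((continuous_fst.comp continuous_snd).tendsto z).comp hlim
  have hΘ : Tendsto (fun k => (u k).2.2) atTop (𝓝 z.2.2) :=
    ((continuous_snd.comp continuous_snd).tendsto z).comp hlim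
  have hzΘ : z.2.2 ∈ ThetaSet G :=
    (isClosed_thetaSet G).mem_of_tendsto hΘ (Eventually.of_forall fun k => (hu k).2.2)
  refine ⟨(isClosed_phiSet p).mem_of_tendsto hΦ (Eventually.of_forall fun k => (hu k).1), ?_, hzΘ⟩
  have hn' : (0 : ℝ) < n := by exact_mod_cast hn
  have hbound (k : ℕ) :
      Real.exp (-(c + p * Real.log (u k).2.2.det) / n) ≤ ∏ j, (u k).2.1 j := by
    have hpos : 0 < ∏ j, (u k).2.1 j := Finset.prod_pos fun j _ => (hu k).2.1 j
    rw [← Real.le_log_iff_exp_le hpos, div_le_iff₀ hn']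
    have h1 := hc k
    rw [show u k = ((u k).1, (u k).2.1, (u k).2.2) from rfl, objective_eq] at h1
    have h2 : 0 ≤ (1 / (p : ℝ)) * ∑ j, residual X (u k).1 (u k).2.1 j ⬝ᵥ
        (u k).2.2.mulVec (residual X (u k).1 (u k).2.1 j) :=
      mul_nonneg (by positivity) (Finset.sum_nonneg fun j _ => quadForm_nonneg (hu k).2.2 _)
    have h3 : 0 ≤ l₁ * ∑ j, ∑ i, |(u k).1 i j| := by positivity
    have h4 : 0 ≤ l₂ * ∑ i, ∑ j, if i ≠ j then |(u k).2.2 i j| else 0 :=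
      mul_nonneg hl₂ (Finset.sum_nonneg fun i _ => Finset.sum_nonneg fun j _ => by
        split_ifs <;> positivity)
    linarith
  have hlog : Tendsto (fun k => Real.log (u k).2.2.det) atTop (𝓝 (Real.log z.2.2.det)) :=
    (((Continuous.matrix_det continuous_id).tendsto z.2.2).comp hΘ).log hzΘ.1.det_pos.ne'
  have hprod : Tendsto (fun k => ∏ j, (u k).2.1 j) atTop (𝓝 (∏ j, z.2.1 j)) :=
    tendsto_finsetProd _ fun j _ => tendsto_pi_nhds.1 hD j
  have hle : Real.exp (-(c + p * Real.log z.2.2.det) / n) ≤ ∏ j, z.2.1 j :=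
    le_of_tendsto_of_tendsto'
      ((Real.continuous_exp.tendsto _).comp (((hlog.const_mul _).const_add c).neg.div_const _))
      hprod hbound
  have hne := ((Real.exp_pos _).trans_le hle).ne'
  intro j
  have h0 : 0 ≤ z.2.1 j := ge_of_tendsto' (tendsto_pi_nhds.1 hD j) fun k => ((hu k).2.1 j).le
  exact h0.lt_of_ne' (Finset.prod_ne_zero_iff.1 hne j (Finset.mem_univ j))

/-! ### Convexity in `(Φ, ρ)` -/

lemma quadForm_midpoint (Θ : Matrix (Fin n) (Fin n) ℝ) (a b : Fin n → ℝ) :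
    ((1 / 2 : ℝ) • (a + b)) ⬝ᵥ Θ.mulVec ((1 / 2 : ℝ) • (a + b)) =
      (a ⬝ᵥ Θ.mulVec a + b ⬝ᵥ Θ.mulVec b) / 2 - ((a - b) ⬝ᵥ Θ.mulVec (a - b)) / 4 := by
  simp only [Matrix.mulVec_smul, Matrix.mulVec_add, Matrix.mulVec_sub, smul_dotProduct,
    dotProduct_smul, add_dotProduct, dotProduct_add, sub_dotProduct, dotProduct_sub, smul_eq_mul]
  ring

/-- The diagonal matrix whose scales `ρⱼ = √(Dⱼ)` are the midpoints of those of `D` and `E`. -/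
noncomputable def scaleMidpoint (D E : Fin p → ℝ) : Fin p → ℝ := fun j => ((√(D j) + √(E j)) / 2) ^ 2

lemma scaleMidpoint_mem {D E : Fin p → ℝ} (hD : D ∈ DSet p) (hE : E ∈ DSet p) :
    scaleMidpoint D E ∈ DSet p := fun j => by
  have := Real.sqrt_pos.2 (hD j)
  have := Real.sqrt_pos.2 (hE j)
  unfold scaleMidpoint
  positivity

lemma scaleMidpoint_self {D : Fin p → ℝ} (hD : D ∈ DSet p) : scaleMidpoint D D = D := by
  ext j
  rw [scaleMidpoint, add_self_div_two, Real.sq_sqrt (hD j).le]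

lemma residual_midpoint (X : Matrix (Fin n) (Fin p) ℝ) (Φ Ψ : Matrix (Fin p) (Fin p) ℝ)
    (D E : Fin p → ℝ) (j : Fin p) :
    residual X ((1 / 2 : ℝ) • (Φ + Ψ)) (scaleMidpoint D E) j =
      (1 / 2 : ℝ) • (residual X Φ D j + residual X Ψ E j) := by
  ext i
  have h : √(scaleMidpoint D E j) = (√(D j) + √(E j)) / 2 := Real.sqrt_sq (by positivity)
  have hs : ∑ k, X i k * ((1 / 2 : ℝ) • (Φ + Ψ)) k j =
      (1 / 2 : ℝ) * (∑ k, X i k * Φ k j + ∑ k, X i k * Ψ k j) := by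
    rw [← Finset.sum_add_distrib, Finset.mul_sum]
    refine Finset.sum_congr rfl fun k _ => ?_
    simp only [Matrix.smul_apply, Matrix.add_apply, smul_eq_mul]
    ring
  simp only [Pi.smul_apply, Pi.add_apply, residual_apply, h, hs, smul_eq_mul]
  ring

lemma log_prod_scaleMidpoint {D E : Fin p → ℝ} (hD : D ∈ DSet p) (hE : E ∈ DSet p) :
    (Real.log (∏ j, D j) + Real.log (∏ j, E j)) / 2 ≤ Real.log (∏ j, scaleMidpoint D E j) := by
  rw [Real.log_prod fun j _ => (hD j).ne', Real.log_prod fun j _ => (hE j).ne',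
    Real.log_prod fun j _ => (scaleMidpoint_mem hD hE j).ne', ← Finset.sum_add_distrib,
    Finset.sum_div]
  refine Finset.sum_le_sum fun j _ => ?_
  have h1 := Real.sqrt_pos.2 (hD j)
  have h2 := Real.sqrt_pos.2 (hE j)
  calc (Real.log (D j) + Real.log (E j)) / 2 = Real.log (√(D j) * √(E j)) := by
        rw [Real.log_mul h1.ne' h2.ne', Real.log_sqrt (hD j).le, Real.log_sqrt (hE j).le]
        ring
    _ ≤ Real.log (scaleMidpoint D E j) := by
        refine Real.log_le_log (by positivity) ?_
        unfold scaleMidpoint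
        nlinarith [sq_nonneg (√(D j) - √(E j))]

/-- For fixed `Θ` the objective is convex in `(Φ, ρ)`, strongly so in the residuals. -/
lemma objective_midpoint_le {l₁ l₂ : ℝ} (hl₁ : 0 ≤ l₁) (X : Matrix (Fin n) (Fin p) ℝ)
    (Φ Ψ : Matrix (Fin p) (Fin p) ℝ) {D E : Fin p → ℝ} (hD : D ∈ DSet p) (hE : E ∈ DSet p)
    (Θ : Matrix (Fin n) (Fin n) ℝ) :
    objective l₁ l₂ X ((1 / 2 : ℝ) • (Φ + Ψ), scaleMidpoint D E, Θ) ≤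
      (objective l₁ l₂ X (Φ, D, Θ) + objective l₁ l₂ X (Ψ, E, Θ)) / 2 -
        (1 / (4 * (p : ℝ))) * ∑ j, (residual X Φ D j - residual X Ψ E j) ⬝ᵥ
          Θ.mulVec (residual X Φ D j - residual X Ψ E j) := by
  have hlog := mul_le_mul_of_nonneg_left (log_prod_scaleMidpoint hD hE) (Nat.cast_nonneg (α := ℝ) n)
  have habs : l₁ * ∑ j, ∑ i, |((1 / 2 : ℝ) • (Φ + Ψ)) i j| ≤
      l₁ * ((∑ j, ∑ i, |Φ i j| + ∑ j, ∑ i, |Ψ i j|) / 2) := by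
    refine mul_le_mul_of_nonneg_left ?_ hl₁
    rw [← Finset.sum_add_distrib, Finset.sum_div]
    refine Finset.sum_le_sum fun j _ => ?_
    rw [← Finset.sum_add_distrib, Finset.sum_div]
    refine Finset.sum_le_sum fun i _ => ?_
    rw [Matrix.smul_apply, Matrix.add_apply, smul_eq_mul, abs_mul, abs_of_pos one_half_pos]
    linarith [abs_add_le (Φ i j) (Ψ i j)]
  simp only [objective_eq, residual_midpoint, quadForm_midpoint]
  rw [Finset.sum_sub_distrib, ← Finset.sum_div, ← Finset.sum_div, Finset.sum_add_distrib]
  have hp : 1 / (4 * (p : ℝ)) = 1 / (p : ℝ) / 4 := by rw [div_div, mul_comm]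
  rw [hp]
  linarith

/-! ### Block steps -/

/-- Replace the block of `z` that is updated in step `r` by the corresponding block of `y`. -/
def blockUpdate (r : ℕ) (z y : Params n p) : Params n p :=
  if r % 3 = 0 then (y.1, z.2) else if r % 3 = 1 then (z.1, y.2.1, z.2.2) else (z.1, z.2.1, y.2.2)

/-- The block of `z` that is updated in step `r` is optimal, the other two blocks being kept. -/
def IsBlockMin (G : SimpleGraph (Fin n)) (l₁ l₂ : ℝ) (X : Matrix (Fin n) (Fin p) ℝ) (r : ℕ)
    (z : Params n p) : Prop :=
  ∀ y ∈ feasible p G, objective l₁ l₂ X z ≤ objective l₁ l₂ X (blockUpdate r z y)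

lemma blockUpdate_mem {G : SimpleGraph (Fin n)} (r : ℕ) {z y : Params n p}
    (hz : z ∈ feasible p G) (hy : y ∈ feasible p G) : blockUpdate r z y ∈ feasible p G := by
  unfold blockUpdate
  split_ifs
  · exact ⟨hy.1, hz.2⟩
  · exact ⟨hz.1, hy.2.1, hz.2.2⟩
  · exact ⟨hz.1, hz.2.1, hy.2.2⟩

lemma blockUpdate_self (r : ℕ) (z : Params n p) : blockUpdate r z z = z := by
  unfold blockUpdate
  split_ifs <;> rfl

lemma blockUpdate_blockUpdate_left (r : ℕ) (z w y : Params n p) :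
    blockUpdate r (blockUpdate r z w) y = blockUpdate r z y := by
  unfold blockUpdate
  split_ifs <;> rfl

lemma blockUpdate_congr {r s : ℕ} (h : r % 3 = s % 3) (z y : Params n p) :
    blockUpdate r z y = blockUpdate s z y := by
  simp only [blockUpdate, h]

lemma continuous_blockUpdate (r : ℕ) (y : Params n p) :
    Continuous fun z : Params n p => blockUpdate r z y := by
  unfold blockUpdate
  split_ifs <;> fun_prop

lemma BlockStep.spec {G : SimpleGraph (Fin n)} {l₁ l₂ : ℝ} {X : Matrix (Fin n) (Fin p) ℝ} {r : ℕ}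
    {z w : Params n p} (h : BlockStep G l₁ l₂ X r z w) (hz : z ∈ feasible p G) :
    w ∈ feasible p G ∧ w = blockUpdate r z w ∧
      ∀ y ∈ feasible p G, objective l₁ l₂ X w ≤ objective l₁ l₂ X (blockUpdate r z y) := by
  obtain ⟨w₁, w₂, w₃⟩ := w
  obtain ⟨h0, h1, h2⟩ := h
  have hr : r % 3 = 0 ∨ r % 3 = 1 ∨ r % 3 = 2 := by omega
  obtain hr | hr | hr := hr
  · obtain ⟨e, hm, hmin⟩ := h0 hr
    simp only [Prod.ext_iff] at e hm
    obtain ⟨rfl, rfl⟩ := e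
    refine ⟨⟨hm, hz.2⟩, by simp [blockUpdate, hr], fun y hy => ?_⟩
    simpa [blockUpdate, hr] using isMinOn_iff.1 hmin y.1 hy.1
  · obtain ⟨e, e', hm, hmin⟩ := h1 hr
    simp only at e e' hm
    subst e e'
    refine ⟨⟨hz.1, hm, hz.2.2⟩, by simp [blockUpdate, hr], fun y hy => ?_⟩
    simpa [blockUpdate, hr] using isMinOn_iff.1 hmin y.2.1 hy.2.1
  · obtain ⟨e, e', hm, hmin⟩ := h2 hr
    simp only at e e' hm
    subst e e'
    refine ⟨⟨hz.1, hz.2.1, hm⟩, by simp [blockUpdate, hr], fun y hy => ?_⟩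
    simpa [blockUpdate, hr] using isMinOn_iff.1 hmin y.2.2 hy.2.2

/-- The decrease of the objective in a `Φ`-step or a `D`-step controls the change of the residuals:
the new point is at least as good as the midpoint of the two. -/
lemma BlockStep.sq_residual_sub_le {G : SimpleGraph (Fin n)} {l₁ l₂ : ℝ} (hp : 1 ≤ p)
    (hl₁ : 0 ≤ l₁) {X : Matrix (Fin n) (Fin p) ℝ} {r : ℕ} {z w : Params n p}
    (h : BlockStep G l₁ l₂ X r z w) (hz : z ∈ feasible p G) (hr : r % 3 = 0 ∨ r % 3 = 1)
    (j : Fin p) (i : Fin n) :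
    (residual X z.1 z.2.1 j i - residual X w.1 w.2.1 j i) ^ 2 ≤
      2 * p * (objective l₁ l₂ X z - objective l₁ l₂ X w) := by
  obtain ⟨hw, hwz, hmin⟩ := h.spec hz
  have hΘ : w.2.2 = z.2.2 := by
    rw [hwz]
    obtain hr | hr := hr <;> simp [blockUpdate, hr]
  set y : Params n p := ((1 / 2 : ℝ) • (z.1 + w.1), scaleMidpoint z.2.1 w.2.1, z.2.2) with hydef
  have hy : y ∈ feasible p G := by
    refine ⟨fun a b hab => ?_, scaleMidpoint_mem hz.2.1 hw.2.1, hz.2.2⟩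
    simp [hydef, hz.1 a b hab, hw.1 a b hab]
  have hyu : blockUpdate r z y = y := by
    obtain hr | hr := hr
    · have : w.2 = z.2 := by rw [hwz]; simp [blockUpdate, hr]
      simp [blockUpdate, hr, hydef, this, scaleMidpoint_self hz.2.1]
    · have : w.1 = z.1 := by rw [hwz]; simp [blockUpdate, hr]
      simp [blockUpdate, hr, hydef, this, ← two_smul ℝ z.1, smul_smul]
  have h1 := hmin y hy
  rw [hyu] at h1
  have h2 := objective_midpoint_le (l₂ := l₂) hl₁ X z.1 w.1 hz.2.1 hw.2.1 z.2.2
  have h3 : objective l₁ l₂ X (w.1, w.2.1, z.2.2) = objective l₁ l₂ X w := by rw [← hΘ]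
  rw [h3] at h2
  change _ ≤ (objective l₁ l₂ X z + objective l₁ l₂ X w) / 2 - _ at h2
  have hp' : (0 : ℝ) < p := by exact_mod_cast hp
  have h4 : (residual X z.1 z.2.1 j i - residual X w.1 w.2.1 j i) ^ 2 ≤
      ∑ j, (residual X z.1 z.2.1 j - residual X w.1 w.2.1 j) ⬝ᵥ
        z.2.2.mulVec (residual X z.1 z.2.1 j - residual X w.1 w.2.1 j) :=
    (sq_le_quadForm hz.2.2 (residual X z.1 z.2.1 j - residual X w.1 w.2.1 j) i).trans
      (Finset.single_le_sum (f := fun j => (residual X z.1 z.2.1 j - residual X w.1 w.2.1 j) ⬝ᵥ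
        z.2.2.mulVec (residual X z.1 z.2.1 j - residual X w.1 w.2.1 j))
        (fun j _ => quadForm_nonneg hz.2.2 _) (Finset.mem_univ j))
  have h5 := h1.trans h2
  rw [one_div_mul_eq_div, le_sub_comm, div_le_iff₀ (by positivity)] at h5
  linarith

/-! ### Cluster points of block coordinate descent -/

section BCD

variable {G : SimpleGraph (Fin n)} {l₁ l₂ : ℝ} {X : Matrix (Fin n) (Fin p) ℝ}
  {x : ℕ → Params n p} {z : Params n p}

lemma IsBCDSequence.mem_feasible (hx : IsBCDSequence G l₁ l₂ X x) (r : ℕ) :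
    x r ∈ feasible p G := by
  induction r with
  | zero => exact hx.1
  | succ r ih => exact ((hx.2 r).spec ih).1

lemma IsBCDSequence.antitone_objective (hx : IsBCDSequence G l₁ l₂ X x) :
    Antitone fun r => objective l₁ l₂ X (x r) := by
  refine antitone_nat_of_succ_le fun r => ?_
  have h := ((hx.2 r).spec (hx.mem_feasible r)).2.2 (x r) (hx.mem_feasible r)
  rwa [blockUpdate_self] at h

lemma isBlockMin_of_tendsto {r : ℕ} {u : ℕ → Params n p} {a : ℕ → ℝ} (hz : z ∈ feasible p G)
    (hu : Tendsto u atTop (𝓝 z)) (ha : Tendsto a atTop (𝓝 (objective l₁ l₂ X z)))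
    (h : ∀ y ∈ feasible p G, ∀ k, a k ≤ objective l₁ l₂ X (blockUpdate r (u k) y)) :
    IsBlockMin G l₁ l₂ X r z := fun y hy =>
  le_of_tendsto_of_tendsto' ha
    ((continuousAt_objective_of_feasible l₁ l₂ X (blockUpdate_mem r hz hy)).tendsto.comp
      (((continuous_blockUpdate r y).tendsto z).comp hu)) (h y hy)

/-- A limit of iterates from which the block of step `r` is about to be updated is optimal in that
block. -/
lemma IsBCDSequence.isBlockMin_of_tendsto_before (hx : IsBCDSequence G l₁ l₂ X x)
    (hz : z ∈ feasible p G)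
    (hf : Tendsto (fun r => objective l₁ l₂ X (x r)) atTop (𝓝 (objective l₁ l₂ X z)))
    {ψ : ℕ → ℕ} (hψ : Tendsto ψ atTop atTop) {r : ℕ} (hr : ∀ k, ψ k % 3 = r % 3)
    (hlim : Tendsto (fun k => x (ψ k)) atTop (𝓝 z)) : IsBlockMin G l₁ l₂ X r z :=
  isBlockMin_of_tendsto hz hlim (hf.comp ((tendsto_add_atTop_nat 1).comp hψ)) fun y hy k => by
    rw [← blockUpdate_congr (hr k)]
    exact ((hx.2 (ψ k)).spec (hx.mem_feasible _)).2.2 y hy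

/-- A limit of iterates obtained by updating the block of step `r` is optimal in that block. -/
lemma IsBCDSequence.isBlockMin_of_tendsto_after (hx : IsBCDSequence G l₁ l₂ X x)
    (hz : z ∈ feasible p G)
    (hf : Tendsto (fun r => objective l₁ l₂ X (x r)) atTop (𝓝 (objective l₁ l₂ X z)))
    {ψ : ℕ → ℕ} (hψ : Tendsto ψ atTop atTop) {r : ℕ} (hr : ∀ k, ψ k % 3 = r % 3)
    (hlim : Tendsto (fun k => x (ψ k + 1)) atTop (𝓝 z)) : IsBlockMin G l₁ l₂ X r z :=
  isBlockMin_of_tendsto hz hlim (hf.comp ((tendsto_add_atTop_nat 1).comp hψ)) fun y hy k => by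
    obtain ⟨-, h, hmin⟩ := (hx.2 (ψ k)).spec (hx.mem_feasible _)
    rw [← blockUpdate_congr (hr k), h, blockUpdate_blockUpdate_left]
    exact hmin y hy

lemma IsBCDSequence.tendsto_residual_sub (hp : 1 ≤ p) (hl₁ : 0 ≤ l₁)
    (hx : IsBCDSequence G l₁ l₂ X x) {c : ℝ}
    (hf : Tendsto (fun r => objective l₁ l₂ X (x r)) atTop (𝓝 c))
    {ψ : ℕ → ℕ} (hψ : Tendsto ψ atTop atTop) (hr : ∀ k, ψ k % 3 = 0 ∨ ψ k % 3 = 1)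
    (j : Fin p) (i : Fin n) :
    Tendsto (fun k => residual X (x (ψ k)).1 (x (ψ k)).2.1 j i -
      residual X (x (ψ k + 1)).1 (x (ψ k + 1)).2.1 j i) atTop (𝓝 0) := by
  have h1 : Tendsto (fun k => √(2 * p * (objective l₁ l₂ X (x (ψ k)) -
      objective l₁ l₂ X (x (ψ k + 1))))) atTop (𝓝 0) := by
    have := (((hf.comp hψ).sub (hf.comp ((tendsto_add_atTop_nat 1).comp hψ))).const_mul
      (2 * (p : ℝ))).sqrt
    simpa using this
  refine squeeze_zero_norm (fun k => Real.abs_le_sqrt ?_) h1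
  exact (hx.2 (ψ k)).sq_residual_sub_le hp hl₁ (hx.mem_feasible _) (hr k) j i

/-- The scales `ρⱼ` are determined by the residuals because no column of `X` vanishes. -/
lemma IsBCDSequence.tendsto_sqrt_sub (hp : 1 ≤ p) (hl₁ : 0 ≤ l₁) (hX : ∀ j, ∃ i, X i j ≠ 0)
    (hx : IsBCDSequence G l₁ l₂ X x) {c : ℝ}
    (hf : Tendsto (fun r => objective l₁ l₂ X (x r)) atTop (𝓝 c))
    {ψ : ℕ → ℕ} (hψ : Tendsto ψ atTop atTop) (hr : ∀ k, ψ k % 3 = 1) (j : Fin p) :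
    Tendsto (fun k => √((x (ψ k)).2.1 j) - √((x (ψ k + 1)).2.1 j)) atTop (𝓝 0) := by
  obtain ⟨i, hi⟩ := hX j
  have h := (hx.tendsto_residual_sub hp hl₁ hf hψ (fun k => Or.inr (hr k)) j i).div_const (X i j)
  rw [zero_div] at h
  refine h.congr fun k => ?_
  rw [((hx.2 (ψ k)).2.1 (hr k)).1, residual_apply, residual_apply, div_eq_iff hi]
  ring

lemma tendsto_of_sqrt_sub {u v : ℕ → Params n p} (hv : ∀ k, (v k).2.1 ∈ DSet p)
    (h1 : ∀ k, (v k).1 = (u k).1) (h2 : ∀ k, (v k).2.2 = (u k).2.2)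
    (h : ∀ j, Tendsto (fun k => √((v k).2.1 j) - √((u k).2.1 j)) atTop (𝓝 0))
    (hz : z.2.1 ∈ DSet p) (hu : Tendsto u atTop (𝓝 z)) : Tendsto v atTop (𝓝 z) := by
  have hΦ : Tendsto (fun k => (u k).1) atTop (𝓝 z.1) := (continuous_fst.tendsto z).comp hu
  have hD : Tendsto (fun k => (u k).2.1) atTop (𝓝 z.2.1) :=
    ((continuous_fst.comp continuous_snd).tendsto z).comp hu
  have hΘ : Tendsto (fun k => (u k).2.2) atTop (𝓝 z.2.2) :=
    ((continuous_snd.comp continuous_snd).tendsto z).comp hu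
  refine (hΦ.congr fun k => (h1 k).symm).prodMk_nhds
    ((tendsto_pi_nhds.2 fun j => ?_).prodMk_nhds (hΘ.congr fun k => (h2 k).symm))
  have h3 := ((h j).add (tendsto_pi_nhds.1 hD j).sqrt).pow 2
  rw [zero_add, Real.sq_sqrt (hz j).le] at h3
  refine h3.congr fun k => ?_
  rw [sub_add_cancel, Real.sq_sqrt (hv k j).le]

/-- A limit `z` of iterates from which a `Φ`-step starts is optimal in `D`. The subsequent `D`-steps
minimize at other values of `Φ`, which need not converge to that of `z`; but asymptotically the
`Φ`-steps leave the residuals unchanged, and the dependence of the objective on `D` involves `Φ`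
only through these. -/
lemma IsBCDSequence.isBlockMin_one_of_tendsto_before_zero (hp : 1 ≤ p) (hl₁ : 0 ≤ l₁)
    (hx : IsBCDSequence G l₁ l₂ X x) (hz : z ∈ feasible p G)
    (hf : Tendsto (fun r => objective l₁ l₂ X (x r)) atTop (𝓝 (objective l₁ l₂ X z)))
    {ψ : ℕ → ℕ} (hψ : Tendsto ψ atTop atTop) (hr : ∀ k, ψ k % 3 = 0)
    (hlim : Tendsto (fun k => x (ψ k)) atTop (𝓝 z)) : IsBlockMin G l₁ l₂ X 1 z := by
  intro y hy
  set e : ℕ → Fin p → Fin n → ℝ := fun k j => residual X (x (ψ k)).1 (x (ψ k)).2.1 j -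
    residual X (x (ψ k + 1)).1 (x (ψ k + 1)).2.1 j with hedef
  have he (j : Fin p) : Tendsto (fun k => e k j) atTop (𝓝 0) := tendsto_pi_nhds.2 fun i =>
    hx.tendsto_residual_sub hp hl₁ hf hψ (fun k => Or.inl (hr k)) j i
  have hw (k : ℕ) : (x (ψ k + 1)).2 = (x (ψ k)).2 := ((hx.2 (ψ k)).1 (hr k)).1
  have hΦ : Tendsto (fun k => (x (ψ k)).1) atTop (𝓝 z.1) := (continuous_fst.tendsto z).comp hlim
  have hD : Tendsto (fun k => (x (ψ k)).2.1) atTop (𝓝 z.2.1) :=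
    ((continuous_fst.comp continuous_snd).tendsto z).comp hlim
  have hΘ : Tendsto (fun k => (x (ψ k)).2.2) atTop (𝓝 z.2.2) :=
    ((continuous_snd.comp continuous_snd).tendsto z).comp hlim
  have hlog : Tendsto (fun k => Real.log (∏ j, (x (ψ k)).2.1 j)) atTop
      (𝓝 (Real.log (∏ j, z.2.1 j))) :=
    (tendsto_finsetProd _ fun j _ => tendsto_pi_nhds.1 hD j).log
      (Finset.prod_ne_zero_iff.2 fun j _ => (hz.2.1 j).ne')
  have hres (E : ℕ → Fin p → ℝ) (E' : Fin p → ℝ) (hE : Tendsto E atTop (𝓝 E')) (j : Fin p) :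
      Tendsto (fun k => (residual X (x (ψ k)).1 (E k) j - e k j) ⬝ᵥ
        (x (ψ k)).2.2.mulVec (residual X (x (ψ k)).1 (E k) j - e k j)) atTop
        (𝓝 (residual X z.1 E' j ⬝ᵥ z.2.2.mulVec (residual X z.1 E' j))) := by
    refine tendsto_quadForm hΘ ?_
    have h := (tendsto_residual X hΦ hE j).sub (he j)
    rwa [sub_zero] at h
  -- The difference of the objective at `(Φ', y.D, Θ)` and `(Φ', D, Θ)`, where `Φ'` is the result of
  -- the `Φ`-step; the `ℓ¹` penalties cancel.
  have hdiff : Tendsto (fun k => -(n : ℝ) * (Real.log (∏ j, y.2.1 j) -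
      Real.log (∏ j, (x (ψ k)).2.1 j)) + (1 / (p : ℝ)) *
      (∑ j, (residual X (x (ψ k)).1 y.2.1 j - e k j) ⬝ᵥ
        (x (ψ k)).2.2.mulVec (residual X (x (ψ k)).1 y.2.1 j - e k j) -
      ∑ j, (residual X (x (ψ k)).1 (x (ψ k)).2.1 j - e k j) ⬝ᵥ
        (x (ψ k)).2.2.mulVec (residual X (x (ψ k)).1 (x (ψ k)).2.1 j - e k j))) atTop
      (𝓝 (objective l₁ l₂ X (blockUpdate 1 z y) - objective l₁ l₂ X z)) := by
    have h := ((hlog.const_sub (Real.log (∏ j, y.2.1 j))).const_mul (-(n : ℝ))).add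
      (((tendsto_finsetSum Finset.univ fun j _ => hres (fun _ => y.2.1) y.2.1
        tendsto_const_nhds j).sub (tendsto_finsetSum Finset.univ fun j _ =>
          hres (fun k => (x (ψ k)).2.1) z.2.1 hD j)).const_mul (1 / (p : ℝ)))
    convert h using 2
    rw [show blockUpdate 1 z y = (z.1, y.2.1, z.2.2) from rfl,
      show objective l₁ l₂ X z = objective l₁ l₂ X (z.1, z.2.1, z.2.2) from rfl, objective_eq,
      objective_eq]
    ring
  have hdec : Tendsto (fun k => objective l₁ l₂ X (x (ψ k + 1 + 1)) -
      objective l₁ l₂ X (x (ψ k + 1))) atTop (𝓝 0) := by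
    have := (hf.comp ((tendsto_add_atTop_nat 2).comp hψ)).sub
      (hf.comp ((tendsto_add_atTop_nat 1).comp hψ))
    simpa using this
  refine sub_nonneg.1 (le_of_tendsto_of_tendsto' hdec hdiff fun k => ?_)
  have hmin := ((hx.2 (ψ k + 1)).spec (hx.mem_feasible _)).2.2 y hy
  have hshift (E : Fin p → ℝ) (j : Fin p) :
      residual X (x (ψ k)).1 E j - e k j = residual X (x (ψ k + 1)).1 E j := by
    ext i
    simp only [hedef, Pi.sub_apply, residual_apply, hw k]
    ring
  have hu : blockUpdate (ψ k + 1) (x (ψ k + 1)) y =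
      ((x (ψ k + 1)).1, y.2.1, (x (ψ k)).2.2) := by
    rw [blockUpdate_congr (s := 1) (by have := hr k; omega), ← hw k]
    rfl
  have hu' : objective l₁ l₂ X (x (ψ k + 1)) =
      objective l₁ l₂ X ((x (ψ k + 1)).1, (x (ψ k)).2.1, (x (ψ k)).2.2) := by rw [← hw k]
  rw [hu] at hmin
  refine (sub_le_sub_right hmin _).trans (le_of_eq ?_)
  simp only [hu', hshift, objective_eq]
  ring

/-- Cluster points of block coordinate descent are feasible and optimal in each block. -/
theorem IsBCDSequence.isBlockMin_of_mapClusterPt (hn : 1 ≤ n) (hp : 1 ≤ p) (hl₁ : 0 ≤ l₁)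
    (hl₂ : 0 ≤ l₂) (hX : ∀ j, ∃ i, X i j ≠ 0) (hx : IsBCDSequence G l₁ l₂ X x)
    (hz : MapClusterPt z atTop x) :
    z ∈ feasible p G ∧ ∀ r, IsBlockMin G l₁ l₂ X r z := by
  have : FirstCountableTopology (Params n p) := inferInstanceAs
    (FirstCountableTopology ((Fin p → Fin p → ℝ) × (Fin p → ℝ) × (Fin n → Fin n → ℝ)))
  obtain ⟨φ, hφ, hlim⟩ := hz.tendsto_subseq
  have hzF : z ∈ feasible p G := mem_feasible_of_tendsto hn hl₁ hl₂ X
    (fun k => hx.mem_feasible (φ k)) (fun k => hx.antitone_objective (Nat.zero_le (φ k))) hlim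
  have hf : Tendsto (fun r => objective l₁ l₂ X (x r)) atTop (𝓝 (objective l₁ l₂ X z)) :=
    (tendsto_iff_tendsto_subseq_of_antitone hx.antitone_objective hφ.tendsto_atTop).2
      ((continuousAt_objective_of_feasible l₁ l₂ X hzF).tendsto.comp hlim)
  refine ⟨hzF, ?_⟩
  suffices h : IsBlockMin G l₁ l₂ X 0 z ∧ IsBlockMin G l₁ l₂ X 1 z ∧ IsBlockMin G l₁ l₂ X 2 z by
    intro r y hy
    have hr : r % 3 = 0 ∨ r % 3 = 1 ∨ r % 3 = 2 := by omega
    obtain hr | hr | hr := hr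
    · rw [blockUpdate_congr (s := 0) hr]; exact h.1 y hy
    · rw [blockUpdate_congr (s := 1) hr]; exact h.2.1 y hy
    · rw [blockUpdate_congr (s := 2) hr]; exact h.2.2 y hy
  -- Pass to a subsequence along which the step number `χ k + 1` is constant modulo `3`.
  obtain ⟨s, hs3, χ, hχ, hχs, hχlim⟩ : ∃ s < 3, ∃ χ : ℕ → ℕ, Tendsto χ atTop atTop ∧
      (∀ k, χ k % 3 = s) ∧ Tendsto (fun k => x (χ k + 1)) atTop (𝓝 z) := by
    have hφ1 (k : ℕ) : φ (k + 1) - 1 + 1 = φ (k + 1) :=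
      Nat.sub_add_cancel (Nat.succ_le_of_lt ((Nat.zero_le _).trans_lt (hφ k.lt_succ_self)))
    have hfreq : ∃ᶠ k in atTop, ∃ s : Fin 3, (φ (k + 1) - 1) % 3 = s :=
      (Eventually.of_forall fun k =>
        ⟨⟨(φ (k + 1) - 1) % 3, Nat.mod_lt _ (by norm_num)⟩, rfl⟩).frequently
    obtain ⟨s, hs⟩ := frequently_exists.1 hfreq
    obtain ⟨θ, hθ, hθs⟩ := extraction_of_frequently_atTop hs
    refine ⟨s, s.2, fun k => φ (θ k + 1) - 1, ?_, hθs, ?_⟩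
    · exact (tendsto_sub_atTop_nat 1).comp
        (hφ.tendsto_atTop.comp ((tendsto_add_atTop_nat 1).comp hθ.tendsto_atTop))
    · simp only [hφ1]
      exact hlim.comp ((tendsto_add_atTop_nat 1).comp hθ.tendsto_atTop)
  have hχ1 : Tendsto (fun k => χ k + 1) atTop atTop := (tendsto_add_atTop_nat 1).comp hχ
  interval_cases s
  · have h1 : ∀ k, (χ k + 1) % 3 = 1 := fun k => by have := hχs k; omega
    have hlim2 : Tendsto (fun k => x (χ k + 1 + 1)) atTop (𝓝 z) :=
      tendsto_of_sqrt_sub (fun k => (hx.mem_feasible _).2.1)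
        (fun k => ((hx.2 _).2.1 (h1 k)).1) (fun k => ((hx.2 _).2.1 (h1 k)).2.1)
        (fun j => by simpa using (hx.tendsto_sqrt_sub hp hl₁ hX hf hχ1 h1 j).neg) hzF.2.1 hχlim
    exact ⟨hx.isBlockMin_of_tendsto_after hzF hf hχ hχs hχlim,
      hx.isBlockMin_of_tendsto_before hzF hf hχ1 h1 hχlim,
      hx.isBlockMin_of_tendsto_before hzF hf ((tendsto_add_atTop_nat 1).comp hχ1)
        (fun k => by have := hχs k; simp only [Function.comp]; omega) hlim2⟩
  · -- The iterates before the `D`-step converge to `z` as well.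
    have hlim0 : Tendsto (fun k => x (χ k)) atTop (𝓝 z) :=
      tendsto_of_sqrt_sub (fun k => (hx.mem_feasible _).2.1)
        (fun k => ((hx.2 _).2.1 (hχs k)).1.symm) (fun k => ((hx.2 _).2.1 (hχs k)).2.1.symm)
        (fun j => hx.tendsto_sqrt_sub hp hl₁ hX hf hχ hχs j) hzF.2.1 hχlim
    refine ⟨?_, hx.isBlockMin_of_tendsto_after hzF hf hχ hχs hχlim,
      hx.isBlockMin_of_tendsto_before hzF hf hχ1 (fun k => by have := hχs k; omega) hχlim⟩
    have hpos (k : ℕ) : χ k - 1 + 1 = χ k := by have := hχs k; omega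
    refine hx.isBlockMin_of_tendsto_after hzF hf (ψ := fun k => χ k - 1)
      ((tendsto_sub_atTop_nat 1).comp hχ) (fun k => by have := hχs k; omega) ?_
    simpa only [hpos] using hlim0
  · have h0 : ∀ k, (χ k + 1) % 3 = 0 := fun k => by have := hχs k; omega
    exact ⟨hx.isBlockMin_of_tendsto_before hzF hf hχ1 h0 hχlim,
      hx.isBlockMin_one_of_tendsto_before_zero hp hl₁ hzF hf hχ1 h0 hχlim,
      hx.isBlockMin_of_tendsto_after hzF hf hχ hχs hχlim⟩

end BCD

/-! ### Directional derivatives -/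

/-- `m` is the one-sided directional derivative of `f` at `z` in the sense of Hadamard, along all
arcs that approach `z`: the difference quotients along `z + dₖ` converge to `m v` whenever
`dₖ → 0` and `cₖ dₖ → v` with `cₖ ≥ 0`. This is the form in which tangent directions are given. -/
def HasDirDerivAt {E : Type*} [AddCommGroup E] [Module ℝ E] [TopologicalSpace E] (f : E → ℝ)
    (m : E → ℝ) (z : E) : Prop :=
  ∀ ⦃α : Type⦄ ⦃l : Filter α⦄ ⦃c : α → ℝ⦄ ⦃d : α → E⦄ ⦃v : E⦄, (∀ k, 0 ≤ c k) →
    Tendsto d l (𝓝 0) → Tendsto (fun k => c k • d k) l (𝓝 v) →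
    Tendsto (fun k => c k * (f (z + d k) - f z)) l (𝓝 (m v))

section General

variable {E : Type*} [AddCommGroup E] [Module ℝ E] [TopologicalSpace E] {f g m m' : E → ℝ} {z : E}

lemma HasDirDerivAt.add (hf : HasDirDerivAt f m z) (hg : HasDirDerivAt g m' z) :
    HasDirDerivAt (fun w => f w + g w) (fun v => m v + m' v) z := fun _ _ c d _ hc hd hv => by
  refine ((hf hc hd hv).add (hg hc hd hv)).congr fun k => ?_
  ring

lemma HasDirDerivAt.const_mul (a : ℝ) (hf : HasDirDerivAt f m z) :
    HasDirDerivAt (fun w => a * f w) (fun v => a * m v) z := fun _ _ c d _ hc hd hv => by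
  refine ((hf hc hd hv).const_mul a).congr fun k => ?_
  ring

lemma HasDirDerivAt.sum {ι : Type*} (s : Finset ι) {f m : ι → E → ℝ}
    (h : ∀ i, HasDirDerivAt (f i) (m i) z) :
    HasDirDerivAt (fun w => ∑ i ∈ s, f i w) (fun v => ∑ i ∈ s, m i v) z :=
  fun _ _ c d _ hc hd hv => by
  refine (tendsto_finsetSum s fun i _ => h i hc hd hv).congr fun k => ?_
  rw [← Finset.sum_sub_distrib, Finset.mul_sum]

lemma HasFDerivAt.hasDirDerivAt {f' : E →L[ℝ] ℝ} [ContinuousAdd E] [ContinuousSMul ℝ E]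
    (h : HasFDerivAt f f' z) : HasDirDerivAt f f' z := fun _ _ _ _ _ _ hd hv =>
  (hasFDerivWithinAt_univ.2 h).lim hd (Eventually.of_forall fun _ => Set.mem_univ _) hv

/-- The one-sided derivative of `|·|` at `a`. -/
noncomputable def absDirDeriv (a s : ℝ) : ℝ := if a = 0 then |s| else SignType.sign a * s

lemma hasDirDerivAt_abs [ContinuousAdd E] [ContinuousSMul ℝ E] (φ : E →L[ℝ] ℝ) (z : E) :
    HasDirDerivAt (fun w => |φ w|) (fun v => absDirDeriv (φ z) (φ v)) z := by
  intro α l c d v hc hd hv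
  by_cases h0 : φ z = 0
  · have h := ((φ.continuous.tendsto v).comp hv).abs
    simp only [absDirDeriv, h0, if_true]
    refine h.congr fun k => ?_
    simp [h0, abs_mul, abs_of_nonneg (hc k)]
  · simp only [absDirDeriv, h0, if_false]
    have hd' : Tendsto (fun k => φ (d k)) l (𝓝 0) := by
      simpa [Function.comp_def] using (φ.continuous.tendsto 0).comp hd
    have hv' : Tendsto (fun k => c k • φ (d k)) l (𝓝 (φ v)) := by
      simpa [Function.comp_def] using (φ.continuous.tendsto v).comp hv
    have h := HasFDerivAt.hasDirDerivAt (hasDerivAt_abs h0).hasFDerivAt hc hd' hv'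
    simpa [mul_comm] using h

lemma tendsto_smul_nhdsGT_zero [ContinuousSMul ℝ E] (v : E) :
    Tendsto (fun t : ℝ => t • v) (𝓝[>] 0) (𝓝 0) := by
  have : Continuous fun t : ℝ => t • v := by fun_prop
  have h := this.tendsto 0
  rw [zero_smul] at h
  exact h.mono_left nhdsWithin_le_nhds

lemma HasDirDerivAt.tendsto_slope [ContinuousSMul ℝ E] (hf : HasDirDerivAt f m z) (v : E) :
    Tendsto (fun t : ℝ => (f (z + t • v) - f z) / t) (𝓝[>] 0) (𝓝 (m v)) := by
  -- The factor `max t⁻¹ 0` is `t⁻¹` for the relevant `t > 0`, and nonnegative for all `t`.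
  have h : Tendsto (fun t : ℝ => max t⁻¹ 0 * (f (z + t • v) - f z)) (𝓝[>] 0) (𝓝 (m v)) := by
    refine hf (fun t => le_max_right _ _) (tendsto_smul_nhdsGT_zero v)
      (tendsto_const_nhds.congr' ?_)
    filter_upwards [self_mem_nhdsWithin] with t ht
    have ht : 0 < t := ht
    rw [max_eq_left (by positivity), smul_smul, inv_mul_cancel₀ ht.ne', one_smul]
  refine h.congr' ?_
  filter_upwards [self_mem_nhdsWithin] with t ht
  have ht : 0 < t := ht
  rw [max_eq_left (by positivity), inv_mul_eq_div]

end General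

section Smooth

-- Any norm on matrices will do: differentiability depends only on the topology.
attribute [local instance] Matrix.normedAddCommGroup Matrix.normedSpace

lemma differentiable_entry (i j : Fin n) :
    Differentiable ℝ fun M : Matrix (Fin n) (Fin n) ℝ => M i j :=
  (Matrix.entryLinearMap ℝ ℝ i j : Matrix (Fin n) (Fin n) ℝ →ₗ[ℝ] ℝ)
    |>.toContinuousLinearMap.differentiable

lemma differentiable_det :
    Differentiable ℝ (Matrix.det : Matrix (Fin n) (Fin n) ℝ → ℝ) := by
  have h := differentiable_entry (n := n)
  have : (Matrix.det : Matrix (Fin n) (Fin n) ℝ → ℝ) = fun M => _ :=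
    funext fun M => Matrix.det_apply' M
  rw [this]
  fun_prop

lemma differentiableAt_negLogLik (X : Matrix (Fin n) (Fin p) ℝ) {z : Params n p}
    (hD : z.2.1 ∈ DSet p) (hΘ : z.2.2.det ≠ 0) : DifferentiableAt ℝ (negLogLik X) z := by
  have hentry (i j : Fin n) : Differentiable ℝ fun z : Params n p => z.2.2 i j :=
    (differentiable_entry i j).comp (differentiable_snd.comp differentiable_snd)
  have hentry' (i j : Fin p) : Differentiable ℝ fun z : Params n p => z.1 i j :=
    (differentiable_entry i j).comp differentiable_fst
  have hsqrt (j : Fin p) : DifferentiableAt ℝ (fun z : Params n p => √(z.2.1 j)) z :=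
    DifferentiableAt.sqrt (by fun_prop) (hD j).ne'
  have hres (j : Fin p) (i : Fin n) :
      DifferentiableAt ℝ (fun z : Params n p => residual X z.1 z.2.1 j i) z := by
    simp only [residual_apply]
    fun_prop
  have hdet : DifferentiableAt ℝ (fun z : Params n p => Real.log z.2.2.det) z :=
    (differentiable_det.differentiableAt.comp z (by fun_prop)).log hΘ
  have hprod : DifferentiableAt ℝ (fun z : Params n p => Real.log (∏ j, z.2.1 j)) z :=
    DifferentiableAt.log (by fun_prop) (Finset.prod_ne_zero_iff.2 fun j _ => (hD j).ne')
  have : negLogLik X = fun z : Params n p => -(n : ℝ) * Real.log (∏ j, z.2.1 j)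
      - (p : ℝ) * Real.log z.2.2.det + (1 / (p : ℝ)) * ∑ j, ∑ i, residual X z.1 z.2.1 j i *
        ∑ k, z.2.2 i k * residual X z.1 z.2.1 j k := by
    funext z
    simp only [negLogLik, trace_mul_scatter, Matrix.det_diagonal, Matrix.mulVec, dotProduct]
  rw [this]
  fun_prop

lemma exists_hasDirDerivAt_negLogLik (X : Matrix (Fin n) (Fin p) ℝ) {z : Params n p}
    (hD : z.2.1 ∈ DSet p) (hΘ : z.2.2.det ≠ 0) :
    ∃ L : Params n p →ₗ[ℝ] ℝ, HasDirDerivAt (negLogLik X) L z :=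
  ⟨(fderiv ℝ (negLogLik X) z).toLinearMap,
    HasFDerivAt.hasDirDerivAt (differentiableAt_negLogLik X hD hΘ).hasFDerivAt⟩

end Smooth


/-- The directional derivative of the objective: a linear functional `L`, contributed by the smooth
part, plus those of the absolute values in the penalties. It is additive over the blocks. -/
noncomputable def objectiveDirDeriv (l₁ l₂ : ℝ) (L : Params n p →ₗ[ℝ] ℝ) (z v : Params n p) : ℝ :=
  L v + l₁ * ∑ j, ∑ i, absDirDeriv (z.1 i j) (v.1 i j)
    + l₂ * ∑ i, ∑ j, if i ≠ j then absDirDeriv (z.2.2 i j) (v.2.2 i j) else 0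

lemma hasDirDerivAt_abs_phi (z : Params n p) (i j : Fin p) :
    HasDirDerivAt (fun w : Params n p => |w.1 i j|)
      (fun v => absDirDeriv (z.1 i j) (v.1 i j)) z :=
  hasDirDerivAt_abs
    { toFun := fun w : Params n p => w.1 i j
      map_add' := fun _ _ => rfl
      map_smul' := fun _ _ => rfl
      cont := continuous_fst.matrix_elem i j } z

lemma hasDirDerivAt_abs_theta (z : Params n p) (i j : Fin n) :
    HasDirDerivAt (fun w : Params n p => |w.2.2 i j|)
      (fun v => absDirDeriv (z.2.2 i j) (v.2.2 i j)) z :=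
  hasDirDerivAt_abs
    { toFun := fun w : Params n p => w.2.2 i j
      map_add' := fun _ _ => rfl
      map_smul' := fun _ _ => rfl
      cont := (continuous_snd.comp continuous_snd).matrix_elem i j } z

lemma exists_hasDirDerivAt_objective (l₁ l₂ : ℝ) (X : Matrix (Fin n) (Fin p) ℝ)
    {z : Params n p} (hD : z.2.1 ∈ DSet p) (hΘ : z.2.2.det ≠ 0) :
    ∃ L : Params n p →ₗ[ℝ] ℝ,
      HasDirDerivAt (objective l₁ l₂ X) (objectiveDirDeriv l₁ l₂ L z) z := by
  obtain ⟨L, hL⟩ := exists_hasDirDerivAt_negLogLik X hD hΘ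
  have h1 := (HasDirDerivAt.sum Finset.univ fun j => HasDirDerivAt.sum Finset.univ fun i =>
    hasDirDerivAt_abs_phi z i j).const_mul l₁
  have h2 (i j : Fin n) : HasDirDerivAt (fun w : Params n p => if i ≠ j then |w.2.2 i j| else 0)
      (fun v => if i ≠ j then absDirDeriv (z.2.2 i j) (v.2.2 i j) else 0) z := by
    split_ifs
    · exact hasDirDerivAt_abs_theta z i j
    · intro _ _ _ _ _ _ _ _
      simpa using tendsto_const_nhds
  have h3 := (HasDirDerivAt.sum Finset.univ fun i => HasDirDerivAt.sum Finset.univ fun j =>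
    h2 i j).const_mul l₂
  exact ⟨L, (hL.add h1).add h3⟩

lemma objectiveDirDeriv_eq_add (l₁ l₂ : ℝ) (L : Params n p →ₗ[ℝ] ℝ) (z v : Params n p) :
    objectiveDirDeriv l₁ l₂ L z v = objectiveDirDeriv l₁ l₂ L z (blockUpdate 0 0 v) +
      objectiveDirDeriv l₁ l₂ L z (blockUpdate 1 0 v) +
      objectiveDirDeriv l₁ l₂ L z (blockUpdate 2 0 v) := by
  have h0 (a : ℝ) : absDirDeriv a 0 = 0 := by simp [absDirDeriv]
  have hv : v = blockUpdate 0 0 v + blockUpdate 1 0 v + blockUpdate 2 0 v := by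
    simp [blockUpdate]
  have hL : L v = L (blockUpdate 0 0 v) + L (blockUpdate 1 0 v) + L (blockUpdate 2 0 v) := by
    rw [← map_add, ← map_add, ← hv]
  simp only [objectiveDirDeriv, hL]
  simp [blockUpdate, h0]
  ring

lemma blockUpdate_add (r : ℕ) (z d : Params n p) :
    blockUpdate r z (z + d) = z + blockUpdate r 0 d := by
  unfold blockUpdate
  split_ifs <;> simp [Prod.ext_iff]

lemma smul_blockUpdate (r : ℕ) (c : ℝ) (d : Params n p) :
    c • blockUpdate r 0 d = blockUpdate r 0 (c • d) := by
  unfold blockUpdate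
  split_ifs <;> simp

lemma continuous_blockUpdate_right (r : ℕ) (z : Params n p) :
    Continuous fun y : Params n p => blockUpdate r z y := by
  unfold blockUpdate
  split_ifs <;> fun_prop

/-! ### Stationarity of blockwise minimizers -/

/-- The feasible set is the product of its blocks, so that each block of a tangent direction is
itself a tangent direction; along it, optimality of the block forces the derivative to be
nonnegative. -/
lemma IsBlockMin.objectiveDirDeriv_nonneg {G : SimpleGraph (Fin n)} {l₁ l₂ : ℝ}
    {X : Matrix (Fin n) (Fin p) ℝ} {r : ℕ} {z v : Params n p} {m : Params n p → ℝ}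
    (h : IsBlockMin G l₁ l₂ X r z) (hm : HasDirDerivAt (objective l₁ l₂ X) m z)
    (hv : v ∈ posTangentConeAt (feasible p G) z) : 0 ≤ m (blockUpdate r 0 v) := by
  obtain ⟨α, l, hl, c, d, hd, hdF, hcd⟩ := exists_fun_of_mem_tangentConeAt hv
  have hzero : blockUpdate r (0 : Params n p) 0 = 0 := blockUpdate_self r 0
  have hcont := continuous_blockUpdate_right r (0 : Params n p)
  have hlim := hm (c := fun k => (c k : ℝ)) (d := fun k => blockUpdate r 0 (d k))
    (v := blockUpdate r 0 v) (fun k => (c k).coe_nonneg)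
    (by have := (hcont.tendsto 0).comp hd; rwa [hzero] at this)
    (((hcont.tendsto v).comp hcd).congr fun k => (smul_blockUpdate r _ _).symm)
  refine ge_of_tendsto hlim (hdF.mono fun k hk => mul_nonneg (c k).coe_nonneg (sub_nonneg.2 ?_))
  rw [← blockUpdate_add]
  exact h _ hk

/-- Version of `mem_posTangentConeAt_of_frequently_mem` that does not need a norm. -/
lemma mem_posTangentConeAt_of_frequently {E : Type*} [AddCommGroup E] [Module ℝ E]
    [TopologicalSpace E] [ContinuousSMul ℝ E] {s : Set E} {z v : E}
    (h : ∃ᶠ t : ℝ in 𝓝[>] 0, z + t • v ∈ s) : v ∈ posTangentConeAt s z := by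
  refine mem_tangentConeAt_of_frequently (𝓝[>] (0 : ℝ)) (fun t => Real.toNNReal t⁻¹)
    (fun t => t • v) (tendsto_smul_nhdsGT_zero v) h (tendsto_const_nhds.congr' ?_)
  filter_upwards [self_mem_nhdsWithin] with t ht
  have ht : 0 < t := ht
  rw [NNReal.smul_def, Real.coe_toNNReal _ (by positivity), smul_smul, inv_mul_cancel₀ ht.ne',
    one_smul]

/-- Nonnegativity of the derivatives in the tangent directions suffices for the extension `g` of `f`
by `⊤` off `s`: a direction `v` with `z + t v ∈ s` for arbitrarily small `t > 0` is tangent, and the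
difference quotients of `g` are `⊤` at all other `t`. -/
lemma isStationaryPoint_of_hasDirDerivAt {E : Type*} [AddCommGroup E] [Module ℝ E]
    [TopologicalSpace E] [ContinuousSMul ℝ E] {f m : E → ℝ} {g : E → EReal} {s : Set E} {z : E}
    (hgs : ∀ w ∈ s, g w = f w) (hgs' : ∀ w ∉ s, g w = ⊤) (hz : z ∈ s) (hm : HasDirDerivAt f m z)
    (h0 : ∀ v ∈ posTangentConeAt s z, 0 ≤ m v) : IsStationaryPoint g z := by
  refine ⟨by rw [hgs z hz]; exact EReal.coe_lt_top _, fun v => ?_⟩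
  rw [lowerDirDeriv, hgs z hz]
  refine le_of_forall_lt fun b hb => ?_
  obtain ⟨b', hbb', hb'⟩ := EReal.lt_iff_exists_real_btwn.1 hb
  refine hbb'.trans_le (le_liminf_of_le (by isBoundedDefault) ?_)
  have hb' : b' < 0 := by exact_mod_cast hb'
  have key : ∀ᶠ t : ℝ in 𝓝[>] 0, z + t • v ∈ s → b' ≤ (f (z + t • v) - f z) / t := by
    by_cases hfreq : ∃ᶠ t : ℝ in 𝓝[>] 0, z + t • v ∈ s
    · have hmv := h0 v (mem_posTangentConeAt_of_frequently hfreq)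
      filter_upwards [(hm.tendsto_slope v).eventually_const_lt (hb'.trans_le hmv)] with t ht _
      exact ht.le
    · filter_upwards [not_frequently.1 hfreq] with t ht ht'
      exact absurd ht' ht
  filter_upwards [key, self_mem_nhdsWithin] with t ht htpos
  have htpos : 0 < t := htpos
  by_cases hmem : z + t • v ∈ s
  · rw [hgs _ hmem, ← EReal.coe_sub, ← EReal.coe_div]
    exact_mod_cast ht hmem
  · rw [hgs' _ hmem, EReal.top_sub_coe,
      EReal.top_div_of_pos_ne_top (by exact_mod_cast htpos) (EReal.coe_ne_top t)]
    exact le_top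

lemma isTangentStationaryOn_of_hasDirDerivAt {E : Type*} [AddCommGroup E] [Module ℝ E]
    [TopologicalSpace E] [ContinuousSMul ℝ E] {f m : E → ℝ} {s : Set E} {z : E} (hz : z ∈ s)
    (hm : HasDirDerivAt f m z) (h0 : ∀ v ∈ posTangentConeAt s z, 0 ≤ m v) :
    IsTangentStationaryOn f s z := by
  refine ⟨hz, fun v hv => ⟨m v, h0 v hv, ?_⟩⟩
  rw [hasDerivWithinAt_iff_tendsto_slope, Set.Ici_sdiff_left]
  refine (hm.tendsto_slope v).congr fun t => ?_
  simp [slope_def_field]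

/-- No column of a generic matrix vanishes. -/
lemma ae_forall_column_ne_zero (hn : 1 ≤ n) :
    ∀ᵐ X : Fin n → Fin p → ℝ, ∀ j, ∃ i, X i j ≠ 0 := by
  refine eventually_countable_forall.2 fun j => ?_
  have h0 : ∀ᵐ a : ℝ, a ≠ 0 := Measure.ae_ne volume 0
  have h1 : ∀ᵐ y : Fin p → ℝ, y j ≠ 0 :=
    (Measure.quasiMeasurePreserving_eval (fun _ : Fin p => (volume : Measure ℝ)) j).ae h0
  have h2 : ∀ᵐ X : Fin n → Fin p → ℝ, X ⟨0, hn⟩ j ≠ 0 :=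
    (Measure.quasiMeasurePreserving_eval
      (fun _ : Fin n => (volume : Measure (Fin p → ℝ))) ⟨0, hn⟩).ae h1
  filter_upwards [h2] with X hX
  exact ⟨_, hX⟩

end NetworkDAG

theorem proposition1 (n p : ℕ) (hn : 1 ≤ n) (hp : 1 ≤ p) (G : SimpleGraph (Fin n))
    (l₁ l₂ : ℝ) (hl₁ : 0 < l₁) (hl₂ : 0 < l₂) :
    ∀ᵐ X : Fin n → Fin p → ℝ,
      ∀ x : ℕ → NetworkDAG.Params n p,
        NetworkDAG.IsBCDSequence G l₁ l₂ (Matrix.of X) x →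
        ∀ z : NetworkDAG.Params n p, MapClusterPt z atTop x →
          NetworkDAG.IsStationaryPoint
            (NetworkDAG.extObjective G l₁ l₂ (Matrix.of X)) z ∧
          NetworkDAG.IsTangentStationaryOn
            (NetworkDAG.objective l₁ l₂ (Matrix.of X)) (NetworkDAG.feasible p G) z := by
  filter_upwards [NetworkDAG.ae_forall_column_ne_zero (p := p) hn] with X hX x hx z hz
  obtain ⟨hzF, hmin⟩ := hx.isBlockMin_of_mapClusterPt hn hp hl₁.le hl₂.le hX hz
  obtain ⟨L, hL⟩ := NetworkDAG.exists_hasDirDerivAt_objective l₁ l₂ (Matrix.of X) hzF.2.1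
    hzF.2.2.1.det_pos.ne'
  have h0 : ∀ v ∈ posTangentConeAt (NetworkDAG.feasible p G) z,
      0 ≤ NetworkDAG.objectiveDirDeriv l₁ l₂ L z v := fun v hv => by
    rw [NetworkDAG.objectiveDirDeriv_eq_add]
    exact add_nonneg (add_nonneg ((hmin 0).objectiveDirDeriv_nonneg hL hv)
      ((hmin 1).objectiveDirDeriv_nonneg hL hv)) ((hmin 2).objectiveDirDeriv_nonneg hL hv)
  exact ⟨NetworkDAG.isStationaryPoint_of_hasDirDerivAt (fun _ h => if_pos h)
      (fun _ h => if_neg h) hzF hL h0,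
    NetworkDAG.isTangentStationaryOn_of_hasDirDerivAt hzF hL h0⟩
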